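/- Let $p$ be a prime and let $\mathbb{C}_p$ be the completion of an algebraic closure of $\mathbb{Q}_p$. An entire function on $\mathbb{C}_p$ is a function $f:\mathbb{C}_p\to\mathbb{C}_p$ given on all of $\mathbb{C}_p$ by a single everywhere convergent power series $f(x)=\sum_{m\ge 0} a_m x^m$ with $a_m\in\mathbb{C}_p$; it is called transcendental if it is not a polynomial function. **Theorem 3.1.** Let $P\in\mathbb{C}_p[x]$ be a non-constant polynomial and let $f$ be a transcendental entire function on $\mathbb{C}_p$ such that $P\circ f=f\circ P$. Then one of the following holds: (i) $P(x)=x$; (ii) $P(x)=ax+b$ with $a,b\in\mathbb{C}_p$, where $a\neq 1$ is a root of unity; moreover, if $n$ denotes the smallest positive integer with $a^n=1$, then there are coefficients $c_k\in\mathbb{C}_p$ ($k\ge 0$) such that, for every $x\in\mathbb{C}_p$, $$f(x)=\frac{b}{1-a}+\sum_{k\ge 0} c_k\left(x-\frac{b}{1-a}\right)^{nk+1},$$ the series being convergent. -/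

import Mathlib

/-- `f` is an entire function on `ℂ_[p]`: it is given on all of `ℂ_[p]` by one everywhere convergent
power series `∑ aₙ xⁿ`. (Over a totally disconnected field this is stronger than being
locally analytic at every point.) -/
def IsPadicEntire (p : ℕ) [Fact p.Prime] (f : ℂ_[p] → ℂ_[p]) : Prop :=
  ∃ a : ℕ → ℂ_[p], ∀ x : ℂ_[p], HasSum (fun n : ℕ => a n * x ^ n) (f x)

/-- `f` is a transcendental entire function on `ℂ_[p]`: an entire function that is not a
polynomial function. -/
def IsPadicTranscendentalEntire (p : ℕ) [Fact p.Prime] (f : ℂ_[p] → ℂ_[p]) : Prop :=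
  IsPadicEntire p f ∧ ¬ ∃ Q : Polynomial ℂ_[p], ∀ x : ℂ_[p], f x = Q.eval x

/-! Far from the origin `|P(z)| = |A| |z|^d`, with `A` the leading coefficient and `d` the degree,
so `P` maps large discs onto discs. If `M(r)` bounds `f` on the disc of radius `r`, commutation
gives the bound `|A| M(r)^d` on the disc of radius `|A| r^d`. For `d ≥ 2`, iterating this yields
polynomial growth of `f` along a sequence of radii, and Cauchy's estimate makes `f` a polynomial
(`exists_polynomial_of_commute_of_two_le`). Hence `d = 1`. A translation by `b ≠ 0` is excluded
because `f(x) - f(0) - x` would vanish at the points `p^n b`, which tend to `0`. For `a ≠ 1`, moving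
the fixed point `b / (1 - a)` to `0` turns the map into `x ↦ a x`, and comparing coefficients forces
`a^(m-1) = 1` wherever the `m`-th coefficient is nonzero. -/

open Filter Topology

/-- Outside a large disc the leading term of a polynomial dominates all the others. -/
lemma Polynomial.exists_forall_norm_coeff_mul_pow_lt {K : Type*} [NormedField K]
    {P : Polynomial K} (hP : 0 < P.natDegree) : ∃ R : ℝ, 1 ≤ R ∧ ∀ B, R ≤ B → ∀ i < P.natDegree,
      ‖P.coeff i‖ * B ^ i < ‖P.leadingCoeff‖ * B ^ P.natDegree := by
  have hl : 0 < ‖P.leadingCoeff‖ := by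
    rw [norm_pos_iff, Polynomial.leadingCoeff_ne_zero]; rintro rfl; simp at hP
  set S := ∑ i ∈ Finset.range P.natDegree, ‖P.coeff i‖ with hS
  have hS0 : 0 ≤ S := Finset.sum_nonneg fun _ _ ↦ norm_nonneg _
  -- The quotient gives `S < ‖P.leadingCoeff‖ * B`; the summand `1` gives `B ≥ 1`, so lower powers
  -- of `B` are at most `B ^ (d - 1)`.
  refine ⟨1 + S / ‖P.leadingCoeff‖, le_add_of_nonneg_right (by positivity), fun B hB i hi ↦ ?_⟩
  have hB1 : 1 ≤ B := le_trans (le_add_of_nonneg_right (by positivity)) hB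
  have hiS : ‖P.coeff i‖ ≤ S :=
    Finset.single_le_sum (f := fun i ↦ ‖P.coeff i‖) (fun _ _ ↦ norm_nonneg _)
      (Finset.mem_range.2 hi)
  have hSB : S < ‖P.leadingCoeff‖ * B := by
    have : S / ‖P.leadingCoeff‖ < B := by linarith
    rwa [div_lt_iff₀' hl] at this
  calc ‖P.coeff i‖ * B ^ i ≤ S * B ^ (P.natDegree - 1) := by
        gcongr
        omega
    _ < ‖P.leadingCoeff‖ * B * B ^ (P.natDegree - 1) := by gcongr
    _ = ‖P.leadingCoeff‖ * B ^ P.natDegree := by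
        rw [mul_assoc, ← pow_succ', Nat.sub_add_cancel hP]

/-! ### Ultrametric estimates for series and polynomials -/

section Ultrametric

variable {K : Type*} [NormedField K] [IsUltrametricDist K]

lemma HasSum.norm_le_of_forall_norm_le {u : ℕ → K} {s : K} (hu : HasSum u s) {C : ℝ}
    (h : ∀ n, ‖u n‖ ≤ C) : ‖s‖ ≤ C := by
  rw [← hu.tsum_eq]
  exact IsUltrametricDist.norm_tsum_le_of_forall_le h

/-- Cauchy's estimate, on a sphere through an element `x` of the field. -/
lemma norm_coeff_mul_pow_le [IsAlgClosed K] {p : ℕ} (hp : 1 < p) [CharZero K]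
    (hpK : ∀ m : ℕ, ‖((p * m + 1 : ℕ) : K)‖ = 1) {f : K → K} {a : ℕ → K}
    (hf : ∀ x, HasSum (fun n ↦ a n * x ^ n) (f x)) {x : K} {B : ℝ} (hB : 0 < B)
    (hfB : ∀ y, ‖y‖ ≤ ‖x‖ → ‖f y‖ ≤ B) (k : ℕ) : ‖a k‖ * ‖x‖ ^ k ≤ B := by
  have hlim : Tendsto (fun n ↦ ‖a n * x ^ n‖) atTop (𝓝 0) := by
    simpa [Nat.cofinite_eq_atTop] using (hf x).summable.tendsto_cofinite_zero.norm
  obtain ⟨M, hM⟩ := eventually_atTop.1 (hlim.eventually_le_const hB)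
  -- Averaging over `N`-th roots of unity isolates the `k`-th term, up to a tail. Being `1` modulo
  -- `p`, `N` has norm `1`, so the average loses nothing; `N > M` makes every tail term at most `B`.
  set N := p * (M + k) + 1 with hN
  have hMN : M + k < N := by nlinarith
  have hN0 : N ≠ 0 := by omega
  have : NeZero N := ⟨hN0⟩
  obtain ⟨ζ, hζ⟩ := HasEnoughRootsOfUnity.exists_primitiveRoot K N
  have hζn : ∀ j, ‖ζ ^ j‖ = 1 := fun j ↦ by
    rw [norm_pow, (hζ.isOfFinOrder hN0).norm_eq_one, one_pow]
  -- The weight `(ζ ^ j) ^ (N - k)` is `ζ ^ (-j * k)` written with a natural exponent.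
  have hsum : HasSum (fun n ↦ ∑ j ∈ Finset.range N, (ζ ^ j) ^ (N - k) * (a n * (ζ ^ j * x) ^ n))
      (∑ j ∈ Finset.range N, (ζ ^ j) ^ (N - k) * f (ζ ^ j * x)) :=
    hasSum_sum fun j _ ↦ (hf _).mul_left _
  have hterm : ∀ n, ∑ j ∈ Finset.range N, (ζ ^ j) ^ (N - k) * (a n * (ζ ^ j * x) ^ n)
      = (a n * x ^ n) * ∑ j ∈ Finset.range N, (ζ ^ (N - k + n)) ^ j := fun n ↦ by
    rw [Finset.mul_sum]
    refine Finset.sum_congr rfl fun j _ ↦ ?_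
    rw [mul_pow, ← pow_mul, ← pow_mul, ← pow_mul, add_mul, pow_add, mul_comm j, mul_comm j]
    ring
  simp only [hterm] at hsum
  have hk : ∑ j ∈ Finset.range N, (ζ ^ (N - k + k)) ^ j = (N : K) := by
    rw [Nat.sub_add_cancel (by omega), hζ.pow_eq_one]; simp
  have hsmall : ∀ n, n < N → n ≠ k → ∑ j ∈ Finset.range N, (ζ ^ (N - k + n)) ^ j = 0 := by
    intro n hn hnk
    have h1 : ζ ^ (N - k + n) ≠ 1 := fun h ↦ by
      obtain ⟨c, hc⟩ := (hζ.pow_eq_one_iff_dvd _).1 h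
      have : 0 < c := Nat.pos_of_ne_zero (by rintro rfl; omega)
      have : c < 2 := by
        by_contra! h2
        have := Nat.mul_le_mul_left N h2
        omega
      obtain rfl : c = 1 := by omega
      omega
    have h2 := geom_sum_mul (ζ ^ (N - k + n)) N
    rw [← pow_mul, mul_comm _ N, pow_mul, hζ.pow_eq_one, one_pow, sub_self] at h2
    exact (mul_eq_zero.1 h2).resolve_right (sub_ne_zero.2 h1)
  have hcoef : ‖a k * x ^ k * (N : K)‖ = ‖a k‖ * ‖x‖ ^ k := by
    rw [norm_mul, hN, hpK, mul_one, norm_mul, norm_pow]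
  have hrest := (hasSum_ite_sub_hasSum hsum k).norm_le_of_forall_norm_le (C := B) fun n ↦ by
    split_ifs with hnk
    · simpa using hB.le
    by_cases hn : n < N
    · simpa [hsmall n hn hnk] using hB.le
    · rw [norm_mul]
      refine (mul_le_of_le_one_right (norm_nonneg _) ?_).trans (hM n (by omega))
      refine IsUltrametricDist.norm_sum_le_of_forall_le_of_nonneg zero_le_one fun j _ ↦ ?_
      rw [← pow_mul, hζn]
  have htot : ‖∑ j ∈ Finset.range N, (ζ ^ j) ^ (N - k) * f (ζ ^ j * x)‖ ≤ B := by
    refine IsUltrametricDist.norm_sum_le_of_forall_le_of_nonneg hB.le fun j _ ↦ ?_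
    rw [norm_mul, norm_pow, hζn, one_pow, one_mul]
    exact hfB _ (by rw [norm_mul, hζn, one_mul])
  rw [← hcoef, ← hk]
  rw [norm_sub_rev] at hrest
  -- The isolated term is the sum of the tail error and the weighted sum of values of `f`, both of
  -- norm at most `B`.
  have := (IsUltrametricDist.isNonarchimedean_norm (R := K))
    (a k * x ^ k * ∑ j ∈ Finset.range N, (ζ ^ (N - k + k)) ^ j -
      ∑ j ∈ Finset.range N, (ζ ^ j) ^ (N - k) * f (ζ ^ j * x))
    (∑ j ∈ Finset.range N, (ζ ^ j) ^ (N - k) * f (ζ ^ j * x))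
  rw [sub_add_cancel] at this
  exact this.trans (max_le hrest htot)

lemma Polynomial.exists_norm_eval_le_and_eq {P : Polynomial K} (hP : 0 < P.natDegree) :
    ∃ R : ℝ, 1 ≤ R ∧
      (∀ B, R ≤ B → ∀ z, ‖z‖ ≤ B → ‖P.eval z‖ ≤ ‖P.leadingCoeff‖ * B ^ P.natDegree) ∧
      ∀ z, R ≤ ‖z‖ → ‖P.eval z‖ = ‖P.leadingCoeff‖ * ‖z‖ ^ P.natDegree := by
  obtain ⟨R, hR1, hR⟩ := Polynomial.exists_forall_norm_coeff_mul_pow_lt hP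
  refine ⟨R, hR1, fun B hB z hz ↦ ?_, fun z hz ↦ ?_⟩
  · have hB0 : 0 ≤ B := by linarith
    rw [Polynomial.eval_eq_sum_range]
    refine IsUltrametricDist.norm_sum_le_of_forall_le_of_nonneg (by positivity) fun i hi ↦ ?_
    rw [norm_mul, norm_pow]
    refine (mul_le_mul_of_nonneg_left (pow_le_pow_left₀ (norm_nonneg _) hz i)
      (norm_nonneg _)).trans ?_
    rcases (Nat.lt_succ_iff.1 (Finset.mem_range.1 hi)).lt_or_eq with h | rfl
    · exact (hR B hB i h).le
    · rfl
  · rw [Polynomial.eval_eq_sum_range, Finset.sum_range_succ, ← norm_pow, ← norm_mul]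
    have hne : (Finset.range P.natDegree).Nonempty := Finset.nonempty_range_iff.2 hP.ne'
    obtain ⟨i, hi, hle⟩ := IsUltrametricDist.exists_norm_finsetSum_le_of_nonempty hne
      fun i ↦ P.coeff i * z ^ i
    have hlt : ‖∑ i ∈ Finset.range P.natDegree, P.coeff i * z ^ i‖
        < ‖P.leadingCoeff * z ^ P.natDegree‖ := by
      refine hle.trans_lt ?_
      simpa using hR _ hz i (Finset.mem_range.1 hi)
    exact IsUltrametricDist.norm_add_eq_max_of_norm_ne_norm hlt.ne |>.trans (max_eq_right hlt.le)

end Ultrametric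

/-! ### Everywhere convergent power series: uniqueness, recentring, isolated zeros -/

section PowerSeries

variable {K : Type*} [NontriviallyNormedField K]

lemma hasFPowerSeriesOnBall_ofScalars {f : K → K} {a : ℕ → K}
    (hf : ∀ x, HasSum (fun n ↦ a n * x ^ n) (f x)) :
    HasFPowerSeriesOnBall f (FormalMultilinearSeries.ofScalars K a) 0 ⊤ where
  r_le := by
    refine top_le_iff.2 (ENNReal.eq_top_of_forall_nnreal_le fun r ↦ ?_)
    obtain ⟨x, hx⟩ := NormedField.exists_lt_norm K r
    have hlim := (hf x).summable.tendsto_cofinite_zero.norm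
    rw [Nat.cofinite_eq_atTop, norm_zero] at hlim
    refine FormalMultilinearSeries.le_radius_of_tendsto _ (l := 0) ?_
    refine squeeze_zero (fun _ ↦ by positivity) (fun n ↦ ?_) hlim
    rw [FormalMultilinearSeries.ofScalars_norm, norm_mul, norm_pow]
    gcongr
  r_pos := by simp
  hasSum := fun {y} _ ↦ by
    simpa [FormalMultilinearSeries.ofScalars_apply_eq, mul_comm] using hf y

lemma coeff_unique {f : K → K} {a b : ℕ → K}
    (ha : ∀ x, HasSum (fun n ↦ a n * x ^ n) (f x))
    (hb : ∀ x, HasSum (fun n ↦ b n * x ^ n) (f x)) : a = b :=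
  FormalMultilinearSeries.ofScalars_series_injective K K
    ((hasFPowerSeriesOnBall_ofScalars ha).hasFPowerSeriesAt.eq_formalMultilinearSeries
      (hasFPowerSeriesOnBall_ofScalars hb).hasFPowerSeriesAt)

lemma exists_hasSum_comp_add [CompleteSpace K] {f : K → K} {a : ℕ → K}
    (hf : ∀ x, HasSum (fun n ↦ a n * x ^ n) (f x)) (c : K) :
    ∃ b : ℕ → K, ∀ x, HasSum (fun n ↦ b n * x ^ n) (f (x + c)) := by
  have h := (hasFPowerSeriesOnBall_ofScalars hf).changeOrigin (y := c) (by simp)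
  refine ⟨fun n ↦ ((FormalMultilinearSeries.ofScalars K a).changeOrigin c).coeff n, fun x ↦ ?_⟩
  have := h.hasSum (y := x) (by simp)
  simp only [FormalMultilinearSeries.apply_eq_pow_smul_coeff, smul_eq_mul, zero_add] at this
  simpa only [mul_comm, add_comm] using this

lemma eq_zero_of_hasSum_of_tendsto_zero {g : K → K} {a : ℕ → K}
    (hg : ∀ x, HasSum (fun n ↦ a n * x ^ n) (g x)) {u : ℕ → K} (hu : Tendsto u atTop (𝓝 0))
    (hu0 : ∀ n, u n ≠ 0) (hgu : ∀ n, g (u n) = 0) (x : K) : g x = 0 := by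
  have h := (hasFPowerSeriesOnBall_ofScalars hg).hasFPowerSeriesAt
  have hfr : ∃ᶠ z in 𝓝[≠] (0 : K), g z = 0 :=
    (tendsto_nhdsWithin_iff.2 ⟨hu, .of_forall hu0⟩).frequently (Frequently.of_forall hgu)
  have hz : FormalMultilinearSeries.ofScalars K a = 0 :=
    h.eq_zero_of_eventually (h.analyticAt.frequently_zero_iff_eventually_zero.1 hfr)
  have ha : a = 0 := (FormalMultilinearSeries.ofScalars_series_eq_zero K).1 hz
  exact (hg x).unique (by simp [ha, hasSum_zero])

end PowerSeries

/-! ### Entire functions commuting with a polynomial -/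

section Commuting

variable {K : Type*} [NontriviallyNormedField K]

lemma exists_polynomial_of_coeff_eq_zero {f : K → K} {a : ℕ → K}
    (hf : ∀ x, HasSum (fun n ↦ a n * x ^ n) (f x)) {N : ℕ} (ha : ∀ n, N ≤ n → a n = 0) :
    ∃ Q : Polynomial K, ∀ x, f x = Q.eval x := by
  refine ⟨∑ n ∈ Finset.range N, Polynomial.C (a n) * Polynomial.X ^ n, fun x ↦ ?_⟩
  rw [Polynomial.eval_finsetSum]
  simp only [Polynomial.eval_mul, Polynomial.eval_C, Polynomial.eval_pow, Polynomial.eval_X]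
  exact (hf x).unique (hasSum_sum_of_ne_finset_zero fun n hn ↦ by
    rw [ha n (by simpa using hn), zero_mul])

lemma exists_norm_le_of_norm_le [IsUltrametricDist K] {f : K → K} {a : ℕ → K}
    (hf : ∀ x, HasSum (fun n ↦ a n * x ^ n) (f x)) (x : K) :
    ∃ B : ℝ, 0 < B ∧ ∀ y, ‖y‖ ≤ ‖x‖ → ‖f y‖ ≤ B := by
  have hlim := (hf x).summable.tendsto_cofinite_zero.norm
  rw [Nat.cofinite_eq_atTop] at hlim
  obtain ⟨B, hB⟩ := hlim.bddAbove_range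
  refine ⟨max B 1, by positivity, fun y hy ↦ (hf y).norm_le_of_forall_norm_le fun n ↦ ?_⟩
  refine le_trans ?_ ((hB ⟨n, rfl⟩).trans (le_max_left _ _))
  simp only [norm_mul, norm_pow]
  gcongr

/-- An entire function with polynomial growth along a sequence of spheres is a polynomial. -/
lemma exists_polynomial_of_growth [IsUltrametricDist K] [IsAlgClosed K] [CharZero K]
    {p : ℕ} (hp : 1 < p) (hpK : ∀ m : ℕ, ‖((p * m + 1 : ℕ) : K)‖ = 1) {f : K → K} {a : ℕ → K}
    (hf : ∀ x, HasSum (fun n ↦ a n * x ^ n) (f x)) {x : ℕ → K}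
    (hx : Tendsto (fun n ↦ ‖x n‖) atTop atTop) {C : ℝ} (hC : 0 < C) {k : ℕ}
    (hgrowth : ∀ n, ∀ y, ‖y‖ ≤ ‖x n‖ → ‖f y‖ ≤ C * ‖x n‖ ^ k) :
    ∃ Q : Polynomial K, ∀ x, f x = Q.eval x := by
  refine exists_polynomial_of_coeff_eq_zero hf (N := k + 1) fun m hm ↦ norm_le_zero_iff.1 ?_
  -- For `m > k`, Cauchy's estimate gives `‖a m‖ ≤ C / ‖x n‖`, which tends to `0`.
  refine ge_of_tendsto (hx.const_div_atTop C) ?_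
  filter_upwards [hx.eventually_ge_atTop 1] with n hn
  have h0 : 0 < ‖x n‖ := by linarith
  have h := norm_coeff_mul_pow_le hp hpK hf (x := x n) (by positivity) (hgrowth n) m
  rw [le_div_iff₀ h0]
  have h1 : ‖a m‖ * ‖x n‖ * ‖x n‖ ^ k ≤ C * ‖x n‖ ^ k := by
    refine le_trans ?_ h
    rw [mul_assoc, ← pow_succ']
    gcongr
  exact le_of_mul_le_mul_right h1 (by positivity)

lemma Polynomial.exists_eval_eq {P : Polynomial K} [IsAlgClosed K] (hP : 0 < P.natDegree) (y : K) :
    ∃ x, P.eval x = y := by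
  obtain ⟨x, hx⟩ := IsAlgClosed.exists_root (P - C y) (by
    refine (natDegree_pos_iff_degree_pos.1 ?_).ne'
    rwa [natDegree_sub_C])
  exact ⟨x, by simpa [sub_eq_zero] using hx⟩

/-- A bound for `f` on a disc propagates to the image of that disc under a polynomial commuting
with `f`. -/
lemma norm_le_of_commute [IsAlgClosed K] {P : Polynomial K} (hP : 0 < P.natDegree) {R : ℝ}
    (hle : ∀ B, R ≤ B → ∀ z, ‖z‖ ≤ B → ‖P.eval z‖ ≤ ‖P.leadingCoeff‖ * B ^ P.natDegree)
    (heq : ∀ z, R ≤ ‖z‖ → ‖P.eval z‖ = ‖P.leadingCoeff‖ * ‖z‖ ^ P.natDegree)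
    {f : K → K} (hcomm : ∀ x, P.eval (f x) = f (P.eval x)) {r B : ℝ} (hr0 : 0 ≤ r) (hr : R ≤ r)
    (hB : R ≤ B) (hf : ∀ x, ‖x‖ ≤ r → ‖f x‖ ≤ B) (y : K)
    (hy : ‖y‖ ≤ ‖P.leadingCoeff‖ * r ^ P.natDegree) :
    ‖f y‖ ≤ ‖P.leadingCoeff‖ * B ^ P.natDegree := by
  obtain ⟨x, rfl⟩ := Polynomial.exists_eval_eq hP y
  rw [← hcomm]
  refine hle B hB _ (hf x ?_)
  -- A preimage of norm greater than `r` would have an image of norm greater than `‖P.leadingCoeff‖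
  -- * r ^ d`.
  by_contra! hlt
  rw [heq x (hr.trans hlt.le)] at hy
  have hl : 0 < ‖P.leadingCoeff‖ := by
    rw [norm_pos_iff, Polynomial.leadingCoeff_ne_zero]; rintro rfl; simp at hP
  have := pow_lt_pow_left₀ hlt hr0 hP.ne'
  nlinarith

/-- Put `s = |A| r^(d-1)`. The step `r ↦ |A| r^d` sends `s` to `s^d`, so a bound `r s^k` on `f` is
reproduced with the same `k`. This bound is polynomial in `r`. -/
lemma exists_polynomial_of_commute_of_two_le [IsUltrametricDist K] [IsAlgClosed K] [CharZero K]
    {p : ℕ} (hp : 1 < p) (hpK : ∀ m : ℕ, ‖((p * m + 1 : ℕ) : K)‖ = 1) {f : K → K} {a : ℕ → K}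
    (hf : ∀ x, HasSum (fun n ↦ a n * x ^ n) (f x)) {P : Polynomial K} (hP : 2 ≤ P.natDegree)
    (hcomm : ∀ x, P.eval (f x) = f (P.eval x)) :
    ∃ Q : Polynomial K, ∀ x, f x = Q.eval x := by
  obtain ⟨R, hR1, hle, heq⟩ := Polynomial.exists_norm_eval_le_and_eq (P := P) (by omega)
  obtain ⟨e, he⟩ : ∃ e, P.natDegree = e + 2 := ⟨_, (Nat.sub_add_cancel hP).symm⟩
  rw [he] at hle heq
  set A := P.leadingCoeff with hA
  have hl : 0 < ‖A‖ := by
    rw [norm_pos_iff, hA, Polynomial.leadingCoeff_ne_zero]; rintro rfl; simp at he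
  -- The threshold `2 / ‖A‖` gives `s ≥ 2`: the radii at least double, and the initial bound `B < 2
  -- ^ k` is absorbed by `s ^ k`.
  obtain ⟨x₀, hx₀⟩ := NormedField.exists_lt_norm K (max R (2 / ‖A‖))
  have hx₀R : R ≤ ‖x₀‖ := (le_max_left _ _).trans hx₀.le
  have hx₀A : 2 ≤ ‖A‖ * ‖x₀‖ ^ (e + 1) := by
    have h1 : 2 / ‖A‖ ≤ ‖x₀‖ := (le_max_right _ _).trans hx₀.le
    rw [div_le_iff₀' hl] at h1
    refine h1.trans ?_
    gcongr
    exact le_self_pow₀ (hR1.trans hx₀R) (by omega)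
  obtain ⟨B, hB0, hB⟩ := exists_norm_le_of_norm_le hf x₀
  obtain ⟨k, hk⟩ := pow_unbounded_of_one_lt B one_lt_two
  -- Iterating the leading monomial realises the radii as norms of elements of `K`, as Cauchy's
  -- estimate requires.
  let x : ℕ → K := fun n ↦ (fun z ↦ A * z ^ (e + 2))^[n] x₀
  have hxs : ∀ n, ‖x (n + 1)‖ = ‖A‖ * ‖x n‖ ^ (e + 2) := fun n ↦ by
    simp only [x, Function.iterate_succ_apply', norm_mul, norm_pow]
  have hinv : ∀ n, R ≤ ‖x n‖ ∧ 2 ≤ ‖A‖ * ‖x n‖ ^ (e + 1) ∧ (2 : ℝ) ^ n ≤ ‖x n‖ ∧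
      ∀ y, ‖y‖ ≤ ‖x n‖ → ‖f y‖ ≤ ‖x n‖ * (‖A‖ * ‖x n‖ ^ (e + 1)) ^ k := by
    intro n
    induction n with
    | zero =>
      refine ⟨hx₀R, hx₀A, (pow_zero (2 : ℝ)).trans_le (hR1.trans hx₀R), fun y hy ↦ (hB y hy).trans ?_⟩
      calc B ≤ 1 * 2 ^ k := by linarith
        _ ≤ ‖x₀‖ * (‖A‖ * ‖x₀‖ ^ (e + 1)) ^ k := by
          gcongr
          exact hR1.trans hx₀R
    | succ n ih =>
      obtain ⟨h1, h2, h3, h4⟩ := ih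
      have hx1 : 1 ≤ ‖x n‖ := hR1.trans h1
      have hstep : ‖x (n + 1)‖ = ‖A‖ * ‖x n‖ ^ (e + 1) * ‖x n‖ := by rw [hxs]; ring
      have hdouble : 2 * ‖x n‖ ≤ ‖x (n + 1)‖ := by rw [hstep]; gcongr
      have hmono : ‖x n‖ ≤ ‖x (n + 1)‖ := by linarith
      refine ⟨h1.trans hmono, h2.trans (by gcongr), ?_, fun y hy ↦ ?_⟩
      · rw [pow_succ']
        linarith
      · have hBR : R ≤ ‖x n‖ * (‖A‖ * ‖x n‖ ^ (e + 1)) ^ k :=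
          h1.trans (le_mul_of_one_le_right (by linarith) (one_le_pow₀ (by linarith)))
        have := norm_le_of_commute (P := P) (by omega) (by rwa [he]) (by rwa [he]) hcomm
          (norm_nonneg (x n)) h1 hBR h4 y (by rw [he, ← hA, ← hxs]; exact hy)
        refine this.trans_eq ?_
        rw [he, hxs]
        ring
  have hlim : Tendsto (fun n ↦ ‖x n‖) atTop atTop :=
    tendsto_atTop_mono (fun n ↦ (hinv n).2.2.1) (tendsto_pow_atTop_atTop_of_one_lt one_lt_two)
  refine exists_polynomial_of_growth hp hpK hf hlim (C := ‖A‖ ^ k) (by positivity)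
    (k := 1 + (e + 1) * k) fun n y hy ↦ ((hinv n).2.2.2 y hy).trans_eq ?_
  ring

/-- An entire function commuting with a nontrivial translation is a polynomial. -/
lemma exists_polynomial_of_commute_translation {p : ℕ} [CharZero K] (hp0 : p ≠ 0)
    (hp : ‖(p : K)‖ < 1) {f : K → K} {a : ℕ → K}
    (hf : ∀ x, HasSum (fun n ↦ a n * x ^ n) (f x)) {b : K} (hb : b ≠ 0)
    (hcomm : ∀ x, f (x + b) = f x + b) :
    ∃ Q : Polynomial K, ∀ x, f x = Q.eval x := by
  have hg : ∀ x, HasSum (fun n ↦ (a - Pi.single 0 (f 0) - Pi.single 1 1 : ℕ → K) n * x ^ n)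
      (f x - f 0 - x) := fun x ↦ by
    simp only [Pi.sub_apply, sub_mul]
    refine ((hf x).sub ?_).sub ?_
    · simpa using hasSum_single (f := fun n ↦ (Pi.single 0 (f 0) : ℕ → K) n * x ^ n) 0
        fun n hn ↦ by simp [hn]
    · simpa using hasSum_single (f := fun n ↦ (Pi.single 1 1 : ℕ → K) n * x ^ n) 1
        fun n hn ↦ by simp [hn]
  have hnat : ∀ m : ℕ, f (m * b) = f 0 + m * b := fun m ↦ by
    induction m with
    | zero => simp
    | succ m ih => rw [Nat.cast_succ, add_one_mul, hcomm, ih, add_assoc]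
  have hlim : Tendsto (fun n : ℕ ↦ (p : K) ^ n * b) atTop (𝓝 0) := by
    simpa using (tendsto_pow_atTop_nhds_zero_of_norm_lt_one hp).mul_const b
  have hz := eq_zero_of_hasSum_of_tendsto_zero hg hlim
    (fun n ↦ mul_ne_zero (pow_ne_zero _ (Nat.cast_ne_zero.2 hp0)) hb) fun n ↦ by
      have := hnat (p ^ n)
      push_cast at this
      rw [this]
      ring
  refine ⟨Polynomial.C (f 0) + Polynomial.X, fun x ↦ ?_⟩
  have := hz x
  simp only [Polynomial.eval_add, Polynomial.eval_C, Polynomial.eval_X]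
  linear_combination this

/-- A non-linear entire function commuting with a homothety `x ↦ a * x`, `a ≠ 1`: the multiplier
`a` is a root of unity, and only exponents congruent to `1` modulo its order occur. -/
lemma exists_isPrimitiveRoot_of_commute_homothety {g : K → K} {w : ℕ → K}
    (hg : ∀ x, HasSum (fun n ↦ w n * x ^ n) (g x))
    (htr : ¬ ∃ Q : Polynomial K, ∀ x, g x = Q.eval x) {a : K} (ha0 : a ≠ 0) (ha1 : a ≠ 1)
    (hga : ∀ x, g (a * x) = a * g x) :
    ∃ n : ℕ, 0 < n ∧ IsPrimitiveRoot a n ∧ ∃ c : ℕ → K, ∀ x,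
      HasSum (fun k : ℕ ↦ c k * x ^ (n * k + 1)) (g x) := by
  have hcoeff : ∀ m, w m * a ^ m = a * w m := by
    refine congrFun (coeff_unique (f := fun x ↦ g (a * x)) (fun x ↦ ?_) fun x ↦ ?_)
    · simpa only [mul_pow, mul_assoc] using hg (a * x)
    · simpa only [hga, mul_assoc] using (hg x).mul_left a
  have hpow : ∀ m, w (m + 1) ≠ 0 → a ^ m = 1 := fun m hm ↦ by
    have h : a ^ m * (a * w (m + 1)) = 1 * (a * w (m + 1)) := by
      rw [one_mul]; refine Eq.trans ?_ (hcoeff (m + 1)); ring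
    exact mul_right_cancel₀ (mul_ne_zero ha0 hm) h
  have hw0 : w 0 = 0 := by
    have h : (1 - a) * w 0 = 0 := by linear_combination hcoeff 0
    exact (mul_eq_zero.1 h).resolve_left (sub_ne_zero.2 ha1.symm)
  -- The bound `2 ≤ m` makes the exponent in `a ^ (m - 1) = 1` positive, so `a` has finite order.
  obtain ⟨m, hm, hwm⟩ : ∃ m, 2 ≤ m ∧ w m ≠ 0 := by
    by_contra! h
    exact htr (exists_polynomial_of_coeff_eq_zero hg h)
  obtain ⟨j, rfl⟩ : ∃ j, m = j + 1 := ⟨m - 1, by omega⟩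
  have hfin : 0 < orderOf a :=
    (isOfFinOrder_iff_pow_eq_one.2 ⟨j, by omega, hpow j hwm⟩).orderOf_pos
  refine ⟨orderOf a, hfin, IsPrimitiveRoot.orderOf a, fun k ↦ w (orderOf a * k + 1), fun x ↦ ?_⟩
  have hinj : Function.Injective fun k ↦ orderOf a * k + 1 := fun k l h ↦
    Nat.eq_of_mul_eq_mul_left hfin (Nat.succ_injective h)
  refine (hinj.hasSum_iff (f := fun n ↦ w n * x ^ n) fun i hi ↦ ?_).2 (hg x)
  suffices w i = 0 by rw [this, zero_mul]
  by_contra hne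
  cases i with
  | zero => exact hne hw0
  | succ i =>
    obtain ⟨k, hk⟩ := orderOf_dvd_of_pow_eq_one (hpow i hne)
    exact hi ⟨k, by rw [hk]⟩

/-- A non-polynomial entire function commuting with an affine map `x ↦ a * x + b`, `a ≠ 1`:
the multiplier `a` is a root of unity, and the function is a sparse series at the fixed point. -/
lemma exists_isPrimitiveRoot_of_commute_affine [CompleteSpace K] {f : K → K} {u : ℕ → K}
    (hf : ∀ x, HasSum (fun n ↦ u n * x ^ n) (f x))
    (htr : ¬ ∃ Q : Polynomial K, ∀ x, f x = Q.eval x) {a b : K} (ha0 : a ≠ 0) (ha1 : a ≠ 1)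
    (hcomm : ∀ x, f (a * x + b) = a * f x + b) :
    ∃ n : ℕ, 0 < n ∧ IsPrimitiveRoot a n ∧ ∃ c : ℕ → K, ∀ x,
      HasSum (fun k : ℕ ↦ c k * (x - b / (1 - a)) ^ (n * k + 1)) (f x - b / (1 - a)) := by
  obtain ⟨c, hc⟩ : ∃ c, c = b / (1 - a) := ⟨_, rfl⟩
  -- `c` is the fixed point of the affine map, so conjugating by translation by `c` leaves the
  -- homothety `x ↦ a * x`.
  have hfix : a * c + b = c := by
    have := (eq_div_iff (sub_ne_zero.2 ha1.symm)).1 hc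
    linear_combination -this
  rw [← hc]
  obtain ⟨v, hv⟩ := exists_hasSum_comp_add hf c
  have hg : ∀ x, HasSum (fun n ↦ (v - Pi.single 0 c : ℕ → K) n * x ^ n) (f (x + c) - c) :=
    fun x ↦ by
      simp only [Pi.sub_apply, sub_mul]
      refine (hv x).sub ?_
      simpa using hasSum_single (f := fun n ↦ (Pi.single 0 c : ℕ → K) n * x ^ n) 0
        fun n hn ↦ by simp [hn]
  obtain ⟨n, hn, hroot, w, hw⟩ := exists_isPrimitiveRoot_of_commute_homothety
    (g := fun x ↦ f (x + c) - c) hg (fun ⟨Q, hQ⟩ ↦ htr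
      ⟨Q.comp (Polynomial.X - Polynomial.C c) + Polynomial.C c, fun x ↦ by simp [← hQ]⟩)
    ha0 ha1 fun x ↦ by
      have := hcomm (x + c)
      rw [show a * (x + c) + b = a * x + c by linear_combination hfix] at this
      rw [this]
      linear_combination hfix
  refine ⟨n, hn, hroot, w, fun x ↦ ?_⟩
  simpa only [sub_add_cancel] using hw (x - c)

end Commuting

section PadicComplex

variable (p : ℕ) [Fact p.Prime]

lemma PadicComplex.norm_natCast (m : ℕ) : ‖(m : ℂ_[p])‖ = ‖(m : ℚ_[p])‖ := by
  rw [← map_natCast (algebraMap ℚ_[p] ℂ_[p]), norm_algebraMap']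

lemma PadicComplex.norm_natCast_mul_add_one (m : ℕ) : ‖((p * m + 1 : ℕ) : ℂ_[p])‖ = 1 := by
  rw [PadicComplex.norm_natCast, Padic.norm_natCast_eq_one_iff]
  simp

end PadicComplex

theorem theorem3p1 (p : ℕ) [Fact p.Prime] (P : Polynomial ℂ_[p]) (hP : 0 < P.natDegree)
    (f : ℂ_[p] → ℂ_[p]) (hf : IsPadicTranscendentalEntire p f)
    (hcomm : (fun x : ℂ_[p] => P.eval x) ∘ f = f ∘ (fun x : ℂ_[p] => P.eval x)) :
    P = Polynomial.X ∨
      ∃ (a b : ℂ_[p]) (n : ℕ),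
        P = Polynomial.C a * Polynomial.X + Polynomial.C b ∧
        a ≠ 1 ∧ 0 < n ∧ IsPrimitiveRoot a n ∧
        ∃ c : ℕ → ℂ_[p], ∀ x : ℂ_[p],
          HasSum (fun k : ℕ => c k * (x - b / (1 - a)) ^ (n * k + 1)) (f x - b / (1 - a)) := by
  obtain ⟨⟨u, hu⟩, htr⟩ := hf
  have hprime : p.Prime := Fact.out
  have hcomm' : ∀ x, P.eval (f x) = f (P.eval x) := congrFun hcomm
  have hdeg : P.natDegree = 1 := by
    by_contra h
    exact htr (exists_polynomial_of_commute_of_two_le hprime.one_lt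
      (PadicComplex.norm_natCast_mul_add_one p) hu (by omega) hcomm')
  obtain ⟨a, ha0, b, rfl⟩ := Polynomial.natDegree_eq_one.1 hdeg
  simp only [Polynomial.eval_add, Polynomial.eval_mul, Polynomial.eval_C,
    Polynomial.eval_X] at hcomm'
  by_cases ha1 : a = 1
  · left
    subst ha1
    obtain rfl : b = 0 := by
      by_contra hb
      refine htr (exists_polynomial_of_commute_translation hprime.ne_zero ?_ hu hb fun x ↦ ?_)
      · rw [PadicComplex.norm_natCast]
        exact Padic.norm_p_lt_one
      · simpa using (hcomm' x).symm
    simp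
  · right
    obtain ⟨n, hn, hroot, hc⟩ :=
      exists_isPrimitiveRoot_of_commute_affine hu htr ha0 ha1 fun x ↦ (hcomm' x).symm
    exact ⟨a, b, n, rfl, ha1, hn, hroot, hc⟩
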